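/- \textbf{Proposition (Interlacing).} Let $p,q\ge 1$ and let $T=(T_{i,j})_{i,j\ge 0}$ be a semi-infinite real banded matrix with $p$ subdiagonals and $q$ superdiagonals, i.e. $T_{i,j}=0$ if $i>j+p$ or $j>i+q$, whose extreme diagonals do not vanish: $T_{n+p,n}\neq 0$ and $T_{n,n+q}\ne 0$ for all $n\ge 0$. Let $T^{[N]}=(T_{i,j})_{0\le i,j\le N}$, and let $P_0=1$, $P_{N+1}(x)=\det\big(xI_{N+1}-T^{[N]}\big)$. Let $\nu\in\mathbb{R}^{p\times p}$ and $\xi\in\mathbb{R}^{q\times q}$ be arbitrary lower triangular matrices with ones on the diagonal. The left recursion polynomials $A^{(a)}_n$, $1\le a\le p$, and the right recursion polynomials $B^{(b)}_n$, $1\le b\le q$, are determined by $A^{(a)}T=xA^{(a)}$, $TB^{(b)}=xB^{(b)}$ (where $A^{(a)}=(A^{(a)}_n)_{n\ge0}$ is a row and $B^{(b)}=(B^{(b)}_n)_{n\ge 0}$ a column) and by the initial conditions $A^{(a)}_{j-1}=\nu_{j,a}$ for $1\le j\le p$ and $B^{(b)}_{j-1}=\xi_{j,b}$ for $1\le j\le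 q$. Put $$\alpha_N=(-1)^{(p-1)N}\prod_{i=0}^{N-1}T_{i+p,i},\qquad \beta_N=(-1)^{(q-1)N}\prod_{i=0}^{N-1}T_{i,i+q},$$ let $Q_{n,N}$ be the determinant of the $p\times p$ matrix with rows $\big(A^{(1)}_m,\dots,A^{(p)}_m\big)$, $m=n,N+1,\dots,N+p-1$, and let $R_{n,N}$ be the determinant of the $q\times q$ matrix with rows $\big(B^{(1)}_m,\dots,B^{(q)}_m\big)$, $m=n,N+1,\dots,N+q-1$ (in this order). Let $N\ge 0$ and suppose that $T^{[N]}$ is oscillatory, i.e. totally nonnegative (all minors are $\ge 0$), irreducible and nonsingular. (If $T$ is oscillatory, meaning that all its truncations $T^{[N]}$ are, this is the case for every $N$.) Then: (i) $P_{N+1}$ strictly interlaces $P_N$: the zeros $\lambda^{[N]}_1>\dots>\lambda^{[N]}_{N+1}$ of $P_{N+1}$ and $\lambda^{[N-1]}_1>\dots>\lambda^{[N-1]}_N$ of $P_N$ are all real and simple, and $\lambda^{[N]}_k>\lambda^{[N-1]}_k>\lambda^{[N]}_{k+1}$ for $1\le k\le N$. (ii) $P_{N+1}'(x)P_N(x)-P_N'(x)P_{N+1}(x)>0$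 for all $x\in\mathbb{R}$. In particular, $(P_{N+1}'P_N)(x)>0$ at every zero $x$ of $P_{N+1}$, and $(P_{N+1}P_N')(x)<0$ at every zero $x$ of $P_N$. (iii) The confluent kernel is positive: $\alpha_N\beta_N\sum_{n=0}^{N}Q_{n,N}(x)R_{n,N}(x)>0$ for all $x\in\mathbb{R}$. -/

import Mathlib

open Polynomial

noncomputable section

namespace BandedFavard

/-- `T` is a semi-infinite matrix with `p` subdiagonals and `q` superdiagonals, whose extreme
diagonals have no zero entry. -/
structure IsBanded (p q : ℕ) (T : Matrix ℕ ℕ ℝ) : Prop where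
  lower : ∀ i j, j + p < i → T i j = 0
  upper : ∀ i j, i + q < j → T i j = 0
  sub_ne_zero : ∀ n, T (n + p) n ≠ 0
  super_ne_zero : ∀ n, T n (n + q) ≠ 0

/-- The leading principal submatrix `T^{[N]}`, with rows and columns `0, …, N`. -/
def trunc (T : Matrix ℕ ℕ ℝ) (N : ℕ) : Matrix (Fin (N + 1)) (Fin (N + 1)) ℝ :=
  T.submatrix (fun i => (i : ℕ)) (fun j => (j : ℕ))

/-- All minors are nonnegative. -/
def IsTotallyNonneg {n : ℕ} (A : Matrix (Fin n) (Fin n) ℝ) : Prop :=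
  ∀ (k : ℕ) (r c : Fin k ↪o Fin n), 0 ≤ (A.submatrix r c).det

/-- Oscillatory matrices: totally nonnegative, irreducible and nonsingular. -/
structure IsOscillatory {n : ℕ} (A : Matrix (Fin n) (Fin n) ℝ) : Prop where
  totallyNonneg : IsTotallyNonneg A
  irreducible : A.IsIrreducible
  nonsingular : A.det ≠ 0

/-- `P_0 = 1` and `P_{N+1}` is the characteristic polynomial `det (x I - T^{[N]})`. -/
def charPoly (T : Matrix ℕ ℕ ℝ) : ℕ → ℝ[X]
  | 0 => 1
  | N + 1 => (trunc T N).charpoly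

/-- Initial condition matrices: lower triangular with ones on the diagonal. -/
structure IsLowerUnitriangular {p : ℕ} (ν : Matrix (Fin p) (Fin p) ℝ) : Prop where
  diag : ∀ i, ν i i = 1
  upper : ∀ i j, i < j → ν i j = 0

/-- The left recursion polynomials `A^{(a)}_n` (with `a` counted from `0`), for a matrix with `p`
subdiagonals. The first `p` of them are the constants `A^{(a)}_n = ν n a`; for `n ≥ p` the column
`m = n - p` of the equation `A^{(a)} T = x A^{(a)}` is solved for its last term
`A^{(a)}_n T_{n, m}`. See `leftPoly_init` and `leftPoly_mul`. -/
def leftPoly (p : ℕ) (T : Matrix ℕ ℕ ℝ) (ν : Matrix (Fin p) (Fin p) ℝ) (a : Fin p) (n : ℕ) :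
    ℝ[X] :=
  if h : n < p then C (ν ⟨n, h⟩ a)
  else C (T n (n - p))⁻¹ *
    ∑ k : Fin n, ((if (k : ℕ) = n - p then X else 0) - C (T k (n - p))) * leftPoly p T ν a k
termination_by n
decreasing_by exact k.2

/-- The right recursion polynomials `B^{(b)}_n`, the entries of the right eigenvectors
`T B^{(b)} = x B^{(b)}`, that is, of the left eigenvectors of `Tᵀ`. -/
def rightPoly (q : ℕ) (T : Matrix ℕ ℕ ℝ) (ξ : Matrix (Fin q) (Fin q) ℝ) (b : Fin q) (n : ℕ) :
    ℝ[X] :=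
  leftPoly q T.transpose ξ b n

theorem leftPoly_init (p : ℕ) (T : Matrix ℕ ℕ ℝ) (ν : Matrix (Fin p) (Fin p) ℝ) (a j : Fin p) :
    leftPoly p T ν a j = C (ν j a) := by
  rw [leftPoly, dif_pos j.2]

/-- The equation `A^{(a)} T = x A^{(a)}`, column by column. -/
theorem leftPoly_mul {p : ℕ} {T : Matrix ℕ ℕ ℝ} (ν : Matrix (Fin p) (Fin p) ℝ) (a : Fin p)
    (m : ℕ) (h : T (m + p) m ≠ 0) :
    ∑ k ∈ Finset.range (m + p + 1), leftPoly p T ν a k * C (T k m) = X * leftPoly p T ν a m := by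
  have hp : 0 < p := a.pos
  have e : C (T (m + p) m) * leftPoly p T ν a (m + p) =
      ∑ k ∈ Finset.range (m + p), ((if k = m then X else 0) - C (T k m)) * leftPoly p T ν a k := by
    rw [leftPoly, dif_neg (by omega), Nat.add_sub_cancel, ← mul_assoc, ← C_mul,
      mul_inv_cancel₀ h, C_1, one_mul]
    exact Fin.sum_univ_eq_sum_range
      (fun k => ((if k = m then X else 0) - C (T k m)) * leftPoly p T ν a k) (m + p)
  rw [Finset.sum_range_succ, mul_comm (leftPoly p T ν a (m + p)), e, ← Finset.sum_add_distrib]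
  rw [Finset.sum_eq_single m]
  · simp; ring
  · intro k _ hk
    simp [hk]; ring
  · intro hm
    exact absurd (Finset.mem_range.2 (by omega)) hm

/-- The equation `T B^{(b)} = x B^{(b)}`, row by row. -/
theorem mul_rightPoly {q : ℕ} {T : Matrix ℕ ℕ ℝ} (ξ : Matrix (Fin q) (Fin q) ℝ) (b : Fin q)
    (m : ℕ) (h : T m (m + q) ≠ 0) :
    ∑ k ∈ Finset.range (m + q + 1), C (T m k) * rightPoly q T ξ b k =
      X * rightPoly q T ξ b m := by
  have := leftPoly_mul (T := T.transpose) ξ b m h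
  simpa [rightPoly, mul_comm] using this

/-- `α_N = (-1)^{(p-1)N} T_{p,0} ⋯ T_{N+p-1,N-1}`. -/
def alpha (p : ℕ) (T : Matrix ℕ ℕ ℝ) (N : ℕ) : ℝ :=
  (-1) ^ ((p - 1) * N) * ∏ i ∈ Finset.range N, T (i + p) i

/-- `β_N = (-1)^{(q-1)N} T_{0,q} ⋯ T_{N-1,N+q-1}`. -/
def beta (q : ℕ) (T : Matrix ℕ ℕ ℝ) (N : ℕ) : ℝ :=
  (-1) ^ ((q - 1) * N) * ∏ i ∈ Finset.range N, T i (i + q)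

/-- The determinant `Q_{n,N}` of the `p × p` matrix with columns `A^{(1)}, …, A^{(p)}` and rows
of index `n, N + 1, …, N + p - 1`. -/
def detQ (p : ℕ) (T : Matrix ℕ ℕ ℝ) (ν : Matrix (Fin p) (Fin p) ℝ) (n N : ℕ) : ℝ[X] :=
  Matrix.det (Matrix.of fun i a : Fin p =>
    leftPoly p T ν a (if (i : ℕ) = 0 then n else N + (i : ℕ)))

/-- The determinant `R_{n,N}` of the `q × q` matrix with columns `B^{(1)}, …, B^{(q)}` and rows
of index `n, N + 1, …, N + q - 1`. -/
def detR (q : ℕ) (T : Matrix ℕ ℕ ℝ) (ξ : Matrix (Fin q) (Fin q) ℝ) (n N : ℕ) : ℝ[X] :=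
  Matrix.det (Matrix.of fun i b : Fin q =>
    rightPoly q T ξ b (if (i : ℕ) = 0 then n else N + (i : ℕ)))

/-- `f` (strictly) interlaces `g`: for some `n`, `f` has degree `n + 1` and `g` has degree `n`,
all their zeros are real, and the zeros `lam 0, …, lam n` of `f` and `mu 0, …, mu (n - 1)` of `g`
satisfy `lam 0 > mu 0 > lam 1 > ⋯ > mu (n - 1) > lam n`. -/
def Interlaces (f g : ℝ[X]) : Prop :=
  g ≠ 0 ∧ ∃ (n : ℕ) (lam : Fin (n + 1) → ℝ) (mu : Fin n → ℝ),
    f.natDegree = n + 1 ∧ g.natDegree = n ∧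
    f.roots = Finset.univ.val.map lam ∧ g.roots = Finset.univ.val.map mu ∧
    ∀ k : Fin n, mu k < lam k.castSucc ∧ lam k.succ < mu k

end BandedFavard

end

/-! Everything reduces to the last diagonal entry of `adj(x - T^{[N]})²`. Differentiating `adj(M) *
M = det M` with `M = x - T^{[N]}` shows that this entry is the Wronskian in (ii). It is also the
kernel in (iii), because `α_N Q_{n,N}` and `β_N R_{n,N}` are the entries of the last row and the
last column of `adj(M)`.

To prove positivity, reverse the order of the indices, so that the last index becomes `0`, and call
the resulting matrix `A`. As `adj(x - A) = g(A)` for a nonzero polynomial `g` of degree `N`, it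
suffices that the functional `L(f) = f(A)₀₀` is positive on squares of nonzero polynomials of degree
at most `N` (`IsPosBand.cornerForm_sq_pos`). By Sylvester's criterion this means that the Hankel
determinants of the moments `(A^k)₀₀` are positive. Cauchy–Binet writes them as sums of products of
minors of the Krylov matrices of `A` and `Aᵀ`; total nonnegativity makes all terms nonnegative, and
the leading term is positive by `IsTotallyNonneg.krylovMinor_castLE_pos`.

The same functional excludes nonreal and multiple zeros of `P_{N+1}`, since these would give a
factor `(X - a)² + b²`. Interlacing then follows from Rolle's theorem applied to `P_{N+1} / P_N`. -/

open Matrix Finset in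
/-- The **Cauchy–Binet formula**. -/
theorem Matrix.det_mul_eq_sum_orderEmb {ι R : Type*} [Fintype ι] [LinearOrder ι] [CommRing R]
    {k : ℕ} (B : Matrix (Fin k) ι R) (C : Matrix ι (Fin k) R) :
    (B * C).det = ∑ J : Fin k ↪o ι, (B.submatrix id J).det * (C.submatrix J id).det := by
  have h1 : (B * C).det = ∑ f : Fin k → ι, (∏ i, C (f i) i) * (B.submatrix id f).det := by
    simp only [det_apply', mul_apply, prod_univ_sum, mul_sum, Fintype.piFinset_univ,
      submatrix_apply, id]
    rw [sum_comm]
    refine sum_congr rfl fun f _ => sum_congr rfl fun σ _ => ?_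
    rw [prod_mul_distrib]
    ring
  have h2 : ∑ J : Fin k ↪o ι, (B.submatrix id J).det * (C.submatrix J id).det =
      ∑ x : (Fin k ↪o ι) × Equiv.Perm (Fin k),
        (∏ i, C (x.1 (x.2 i)) i) * (B.submatrix id (x.1 ∘ x.2)).det := by
    rw [Fintype.sum_prod_type]
    refine sum_congr rfl fun J _ => ?_
    rw [det_apply' (C.submatrix J id), mul_sum]
    refine sum_congr rfl fun σ _ => ?_
    have : B.submatrix id (J ∘ σ) = (B.submatrix id J).submatrix id σ := rfl
    rw [this, det_permute']
    simp only [submatrix_apply, id]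
    ring
  rw [h1, h2]
  symm
  refine sum_of_injOn (fun x : (Fin k ↪o ι) × Equiv.Perm (Fin k) => x.1 ∘ x.2) ?_
    (fun _ _ => mem_coe.2 (mem_univ _)) ?_ (fun _ _ => rfl)
  · rintro ⟨J, σ⟩ - ⟨J', σ'⟩ - h
    have h : J ∘ σ = J' ∘ σ' := h
    have hr : Set.range J = Set.range J' := by
      rw [← σ.surjective.range_comp, h, σ'.surjective.range_comp]
    obtain rfl : J = J' := OrderEmbedding.range_inj.1 hr
    simp only [Prod.mk.injEq, true_and]
    ext1 i
    exact J.injective (congrFun h i)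
  · intro f _ hf
    have hinj : ¬ Function.Injective f := by
      intro hinj
      refine hf ⟨(OrderEmbedding.ofStrictMono (f ∘ Tuple.sort f)
        ((Tuple.monotone_sort f).strictMono_of_injective
          (hinj.comp (Tuple.sort f).injective)), (Tuple.sort f)⁻¹), by simp, ?_⟩
      ext i
      simp
    simp only [Function.Injective, not_forall] at hinj
    obtain ⟨i, j, hij, hne⟩ := hinj
    rw [det_zero_of_column_eq hne (by simp [hij]), mul_zero]

open Matrix in
theorem Matrix.det_eq_mul_det_schur {k : ℕ} (M : Matrix (Fin (k + 1)) (Fin (k + 1)) ℝ)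
    (h : M 0 0 ≠ 0) :
    M.det = M 0 0 *
      (Matrix.of fun i j : Fin k => M i.succ j.succ - M i.succ 0 * M 0 j.succ / M 0 0).det := by
  have e : M.det = (Matrix.of fun i j => if i = 0 then M i j else
      M i j - M i 0 * M 0 j / M 0 0).det := by
    refine det_eq_of_forall_row_eq_smul_add_const
      (fun i => if i = 0 then 0 else M i 0 / M 0 0) 0 (by simp) fun i j => ?_
    by_cases hi : i = 0
    · simp [hi]
    · simp [hi]; field_simp; ring
  rw [e, det_succ_column_zero, Fin.sum_univ_succ, Finset.sum_eq_zero]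
  · simp
    left
    congr 1
  · intro i _
    simp [Fin.succ_ne_zero, h]

namespace BandedFavard

variable {n : ℕ}

/-! ### Total nonnegativity, Schur complements and oscillatory matrices -/

theorem IsTotallyNonneg.nonneg {A : Matrix (Fin n) (Fin n) ℝ} (hA : IsTotallyNonneg A)
    (i j : Fin n) : 0 ≤ A i j := by
  have := hA 1 (OrderEmbedding.ofStrictMono ![i] (Subsingleton.strictMono _))
    (OrderEmbedding.ofStrictMono ![j] (Subsingleton.strictMono _))
  rwa [Matrix.det_fin_one] at this

theorem IsTotallyNonneg.minor_two_nonneg {A : Matrix (Fin n) (Fin n) ℝ} (hA : IsTotallyNonneg A)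
    {i i' j j' : Fin n} (hi : i < i') (hj : j < j') : A i j' * A i' j ≤ A i j * A i' j' := by
  have := hA 2 (OrderEmbedding.ofStrictMono ![i, i'] (by
      rw [Fin.strictMono_iff_lt_succ]; intro a; fin_cases a; simpa))
    (OrderEmbedding.ofStrictMono ![j, j'] (by
      rw [Fin.strictMono_iff_lt_succ]; intro a; fin_cases a; simpa))
  rw [Matrix.det_fin_two] at this
  simp at this
  linarith

theorem IsTotallyNonneg.submatrix {m : ℕ} {A : Matrix (Fin n) (Fin n) ℝ} (hA : IsTotallyNonneg A)
    (r c : Fin m ↪o Fin n) : IsTotallyNonneg (A.submatrix r c) :=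
  fun k r' c' => hA k (r'.trans r) (c'.trans c)

theorem IsTotallyNonneg.transpose {A : Matrix (Fin n) (Fin n) ℝ} (hA : IsTotallyNonneg A) :
    IsTotallyNonneg A.transpose := by
  intro k r c
  rw [← Matrix.det_transpose]
  exact hA k c r

theorem IsTotallyNonneg.rev {A : Matrix (Fin n) (Fin n) ℝ} (hA : IsTotallyNonneg A) :
    IsTotallyNonneg (A.submatrix Fin.rev Fin.rev) := by
  intro k r c
  have := hA k (OrderEmbedding.ofStrictMono (fun i => (r i.rev).rev) fun a b h => by simpa using h)
    (OrderEmbedding.ofStrictMono (fun i => (c i.rev).rev) fun a b h => by simpa using h)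
  rw [← Matrix.det_submatrix_equiv_self Fin.revPerm] at this
  convert this using 2
  ext i j
  simp [OrderEmbedding.ofStrictMono]

/-- If the corner vanishes, the `2 × 2` minors containing it force the first row or the first column
to vanish. -/
theorem IsTotallyNonneg.zero_zero_pos {A : Matrix (Fin (n + 1)) (Fin (n + 1)) ℝ}
    (hA : IsTotallyNonneg A) (hdet : A.det ≠ 0) : 0 < A 0 0 := by
  refine lt_of_le_of_ne (hA.nonneg 0 0) fun h0 => hdet ?_
  by_cases hr : ∀ j, A 0 j = 0
  · exact Matrix.det_eq_zero_of_row_eq_zero 0 hr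
  · push Not at hr
    obtain ⟨j, hj⟩ := hr
    refine Matrix.det_eq_zero_of_column_eq_zero 0 fun i => ?_
    rcases Fin.eq_zero_or_eq_succ i with rfl | ⟨i, rfl⟩
    · exact h0.symm
    · have hj0 : 0 < j := Fin.pos_iff_ne_zero.2 fun h => hj (by rw [h, ← h0])
      have := hA.minor_two_nonneg (Fin.succ_pos i) hj0
      rw [← h0, zero_mul] at this
      have hj' : 0 < A 0 j := lt_of_le_of_ne (hA.nonneg _ _) (Ne.symm hj)
      exact le_antisymm (nonpos_of_mul_nonpos_right this hj') (hA.nonneg _ _)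

/-- The Schur complement of the upper left entry. -/
noncomputable def schur (A : Matrix (Fin (n + 1)) (Fin (n + 1)) ℝ) : Matrix (Fin n) (Fin n) ℝ :=
  Matrix.of fun i j => A i.succ j.succ - A i.succ 0 * A 0 j.succ / A 0 0

theorem det_eq_mul_det_schur {A : Matrix (Fin (n + 1)) (Fin (n + 1)) ℝ} (h : A 0 0 ≠ 0) :
    A.det = A 0 0 * (schur A).det :=
  A.det_eq_mul_det_schur h

/-- The order embedding `0 ↦ 0`, `i + 1 ↦ r i + 1`. -/
def consZero {k : ℕ} (r : Fin k ↪o Fin n) : Fin (k + 1) ↪o Fin (n + 1) :=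
  OrderEmbedding.ofStrictMono (Fin.cons 0 fun i => (r i).succ) (by
    rw [Fin.strictMono_iff_lt_succ]
    intro i
    cases k with
    | zero => exact i.elim0
    | succ k =>
      rcases Fin.eq_zero_or_eq_succ i with rfl | ⟨i, rfl⟩
      · simp
      · rw [← Fin.succ_castSucc]; simp)

/-- Adjoining row and column `0` to a minor of the Schur complement gives a minor of `A`, larger by
the factor `A 0 0`. -/
theorem IsTotallyNonneg.schur {A : Matrix (Fin (n + 1)) (Fin (n + 1)) ℝ}
    (hA : IsTotallyNonneg A) (h : 0 < A 0 0) : IsTotallyNonneg (schur A) := by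
  intro k r c
  have h1 := hA (k + 1) (consZero r) (consZero c)
  have e : A.submatrix (consZero r) (consZero c) 0 0 = A 0 0 := by simp [consZero]
  rw [BandedFavard.det_eq_mul_det_schur (by rw [e]; exact h.ne'), e] at h1
  exact nonneg_of_mul_nonneg_right h1 h

theorem IsTotallyNonneg.schur_det_ne_zero {A : Matrix (Fin (n + 1)) (Fin (n + 1)) ℝ}
    (hA : IsTotallyNonneg A) (hdet : A.det ≠ 0) : (BandedFavard.schur A).det ≠ 0 := by
  rw [BandedFavard.det_eq_mul_det_schur (hA.zero_zero_pos hdet).ne'] at hdet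
  exact right_ne_zero_of_mul hdet

/-- Elimination of the corner commutes with truncation and preserves total nonnegativity and
nonsingularity, which allows induction. -/
theorem IsTotallyNonneg.det_castSucc_pos {A : Matrix (Fin (n + 1)) (Fin (n + 1)) ℝ}
    (hA : IsTotallyNonneg A) (hdet : A.det ≠ 0) :
    0 < (A.submatrix Fin.castSucc Fin.castSucc).det := by
  induction n with
  | zero => simp
  | succ n ih =>
    have h0 := hA.zero_zero_pos hdet
    rw [BandedFavard.det_eq_mul_det_schur (by simpa using h0.ne')]
    exact mul_pos (by simpa using h0) (ih (hA.schur h0) (hA.schur_det_ne_zero hdet))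

theorem IsTotallyNonneg.diag_pos {A : Matrix (Fin n) (Fin n) ℝ}
    (hA : IsTotallyNonneg A) (hdet : A.det ≠ 0) (i : Fin n) : 0 < A i i := by
  induction n with
  | zero => exact i.elim0
  | succ n ih =>
    have h0 := hA.zero_zero_pos hdet
    rcases Fin.eq_zero_or_eq_succ i with rfl | ⟨i, rfl⟩
    · exact h0
    · have h1 := ih (hA.schur h0) (hA.schur_det_ne_zero hdet) i
      have h2 : 0 ≤ A i.succ 0 * A 0 i.succ / A 0 0 :=
        div_nonneg (mul_nonneg (hA.nonneg _ _) (hA.nonneg _ _)) h0.le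
      simp only [BandedFavard.schur, Matrix.of_apply] at h1
      linarith

/-- The first subdiagonal of an oscillatory matrix is positive. -/
theorem IsOscillatory.subdiag_pos {A : Matrix (Fin (n + 1)) (Fin (n + 1)) ℝ}
    (hA : IsOscillatory A) (i : Fin n) : 0 < A i.succ i.castSucc := by
  have hT := hA.totallyNonneg
  refine lt_of_le_of_ne (hT.nonneg _ _) fun h0 => ?_
  have hz1 : ∀ j, i.castSucc < j → A j i.castSucc = 0 := by
    intro j hj
    rcases (Fin.castSucc_lt_iff_succ_le.1 hj).eq_or_lt with rfl | hj
    · exact h0.symm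
    · have := hT.minor_two_nonneg hj (Fin.castSucc_lt_succ (i := i))
      rw [← h0, zero_mul] at this
      exact le_antisymm (nonpos_of_mul_nonpos_right this (hT.diag_pos hA.nonsingular _))
        (hT.nonneg _ _)
  -- Against the positive diagonal, `2 × 2` minors spread the zero at `(i + 1, i)` over the whole
  -- lower left block, so no path can leave the indices above `i`.
  have hz : ∀ j l, i.castSucc < j → l ≤ i.castSucc → A j l = 0 := by
    intro j l hj hl
    rcases hl.eq_or_lt with rfl | hl
    · exact hz1 j hj
    · have := hT.minor_two_nonneg hj hl
      rw [hz1 j hj, mul_zero] at this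
      exact le_antisymm (nonpos_of_mul_nonpos_right this (hT.diag_pos hA.nonsingular _))
        (hT.nonneg _ _)
  let := A.toQuiver
  obtain ⟨path, -⟩ := hA.irreducible.connected i.succ i.castSucc
  have key : ∀ {a b : Fin (n + 1)} (_ : Quiver.Path a b), i.castSucc < a → i.castSucc < b := by
    intro a b path
    induction path with
    | nil => exact id
    | cons p e ih =>
      intro ha
      by_contra hb
      have e : 0 < A _ _ := PLift.down e
      exact e.ne' (hz _ _ (ih ha) (not_lt.1 hb))
  exact lt_irrefl _ (key path Fin.castSucc_lt_succ)

/-! ### Minors of Krylov matrices -/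

/-- The minor with rows `I` of the first `k` columns of the Krylov matrix `e₀, A e₀, A² e₀, …`. -/
def krylovMinor (A : Matrix (Fin (n + 1)) (Fin (n + 1)) ℝ) {k : ℕ} (I : Fin k → Fin (n + 1)) : ℝ :=
  (Matrix.of fun i j : Fin k => (A ^ (j : ℕ)) (I i) 0).det

theorem krylovMinor_of_ne_zero (A : Matrix (Fin (n + 1)) (Fin (n + 1)) ℝ) {k : ℕ}
    (I : Fin (k + 1) ↪o Fin (n + 1)) (h : I 0 ≠ 0) : krylovMinor A I = 0 := by
  refine Matrix.det_eq_zero_of_column_eq_zero 0 fun i => ?_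
  have : I i ≠ 0 := fun hi => h (le_antisymm (hi ▸ I.monotone (Fin.zero_le i)) (Fin.zero_le _))
  simp [this]

/-- The first Krylov column is `e₀` and the later ones are `A` times their predecessors, so
expansion along the first column followed by Cauchy–Binet lowers the order by one. -/
theorem krylovMinor_succ (A : Matrix (Fin (n + 1)) (Fin (n + 1)) ℝ) {k : ℕ}
    (I : Fin (k + 1) ↪o Fin (n + 1)) (h : I 0 = 0) : krylovMinor A I =
      ∑ J : Fin k ↪o Fin (n + 1), (A.submatrix (I ∘ Fin.succ) J).det * krylovMinor A J := by
  have h1 : krylovMinor A I =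
      ((A.submatrix (I ∘ Fin.succ) id) *
        (Matrix.of fun i (j : Fin k) => (A ^ (j : ℕ)) i 0)).det := by
    rw [krylovMinor, Matrix.det_succ_column_zero, Fin.sum_univ_succ, Finset.sum_eq_zero]
    · simp only [Fin.val_zero, pow_zero, Matrix.of_apply, h, Matrix.one_apply_eq, one_mul, add_zero,
        Fin.succAbove_zero]
      congr 1
      ext i j
      simp [pow_succ', Matrix.mul_apply]
    · intro i _
      have : I i.succ ≠ 0 := fun hi => (Fin.succ_ne_zero i) (I.injective (hi.trans h.symm))
      simp [this]
  rw [h1, Matrix.det_mul_eq_sum_orderEmb]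
  rfl

theorem IsTotallyNonneg.krylovMinor_nonneg {A : Matrix (Fin (n + 1)) (Fin (n + 1)) ℝ}
    (hA : IsTotallyNonneg A) {k : ℕ} (I : Fin k ↪o Fin (n + 1)) : 0 ≤ krylovMinor A I := by
  induction k with
  | zero => simp [krylovMinor]
  | succ k ih =>
    by_cases h : I 0 = 0
    · rw [krylovMinor_succ A I h]
      exact Finset.sum_nonneg fun J _ =>
        mul_nonneg (hA k ((Fin.succOrderEmb k).trans I) J) (ih J)
    · rw [krylovMinor_of_ne_zero A I h]

/-- Powers do not commute with truncation, hence only an inequality: the expansion for `A` has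
further, nonnegative terms from the sets `J` containing the last index. -/
theorem IsTotallyNonneg.krylovMinor_castSucc_le {A : Matrix (Fin (n + 2)) (Fin (n + 2)) ℝ}
    (hA : IsTotallyNonneg A) {k : ℕ} (I : Fin k ↪o Fin (n + 1)) :
    krylovMinor (A.submatrix Fin.castSucc Fin.castSucc) I ≤
      krylovMinor A (I.trans Fin.castSuccOrderEmb) := by
  have hB : IsTotallyNonneg (A.submatrix Fin.castSucc Fin.castSucc) :=
    hA.submatrix Fin.castSuccOrderEmb Fin.castSuccOrderEmb
  induction k with
  | zero => simp [krylovMinor]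
  | succ k ih =>
    by_cases h : I 0 = 0
    · rw [krylovMinor_succ _ I h, krylovMinor_succ A _ (by simp [h])]
      let φ : (Fin k ↪o Fin (n + 1)) → (Fin k ↪o Fin (n + 2)) :=
        fun J => J.trans Fin.castSuccOrderEmb
      have hφ : Function.Injective φ := fun J J' hJ => by
        ext1 i
        exact Fin.castSucc_injective _ (DFunLike.congr_fun hJ i)
      calc _ ≤ ∑ J : Fin k ↪o Fin (n + 1),
            (A.submatrix (I.trans Fin.castSuccOrderEmb ∘ Fin.succ) (φ J)).det *
              krylovMinor A (φ J) := by
            refine Finset.sum_le_sum fun J _ => ?_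
            exact mul_le_mul_of_nonneg_left (ih J) (hB k ((Fin.succOrderEmb k).trans I) J)
        _ = ∑ J ∈ Finset.univ.map ⟨φ, hφ⟩,
            (A.submatrix (I.trans Fin.castSuccOrderEmb ∘ Fin.succ) J).det *
              krylovMinor A J := by simp
        _ ≤ _ := Finset.sum_le_sum_of_subset_of_nonneg (Finset.subset_univ _) fun J _ _ =>
            mul_nonneg (hA k ((Fin.succOrderEmb k).trans (I.trans Fin.castSuccOrderEmb)) J)
              (hA.krylovMinor_nonneg J)
    · rw [krylovMinor_of_ne_zero _ I h]
      exact hA.krylovMinor_nonneg _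

/-- A left null vector of the Krylov matrix stays one after multiplication with `A`. -/
theorem vecMul_mul_pow_eq_zero {A : Matrix (Fin (n + 1)) (Fin (n + 1)) ℝ} {w : Fin (n + 1) → ℝ}
    (hw : ∀ k ≤ n, ∑ i, w i * (A ^ k) i 0 = 0) (k : ℕ) : ∑ i, w i * (A ^ k) i 0 = 0 := by
  let L : ℝ[X] →ₗ[ℝ] ℝ :=
    { toFun := fun f => ∑ i, w i * (aeval A f) i 0
      map_add' := by intros; simp [mul_add, Finset.sum_add_distrib]
      map_smul' := by intros; simp [Finset.mul_sum, mul_left_comm] }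
  -- By Cayley–Hamilton only the remainder, of degree at most `n`, matters.
  have h1 : L (X ^ k) = L (X ^ k %ₘ A.charpoly) := by
    conv_lhs => rw [← modByMonic_add_div (X ^ k) A.charpoly, map_add]
    simp [L, Matrix.aeval_self_charpoly]
  have h2 : ∀ f : ℝ[X], f.natDegree ≤ n → L f = 0 := by
    intro f hf
    rw [f.as_sum_range_C_mul_X_pow' (Nat.lt_succ_of_le hf), map_sum]
    refine Finset.sum_eq_zero fun i hi => ?_
    rw [← smul_eq_C_mul, map_smul]
    have := hw i (Nat.lt_succ_iff.1 (Finset.mem_range.1 hi))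
    simp [L, this]
  have h3 : L (X ^ k) = ∑ i, w i * (A ^ k) i 0 := by simp [L]
  rw [← h3, h1]
  refine h2 _ (Nat.lt_succ_iff.1 ?_)
  have := natDegree_modByMonic_lt (X ^ k) A.charpoly_monic
    (fun h => by simpa [h] using A.charpoly_natDegree_eq_dim)
  simpa [A.charpoly_natDegree_eq_dim] using this

/-- If the row vector with entries `(-1)^j v j`, `v ≥ 0`, is a left eigenvector of a nonsingular
totally nonnegative matrix, then `A i j = 0` whenever `v i ≠ 0` and `v j = 0`. -/
theorem IsTotallyNonneg.apply_eq_zero_of_alternating {A : Matrix (Fin (n + 1)) (Fin (n + 1)) ℝ}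
    (hA : IsTotallyNonneg A) (hdet : A.det ≠ 0) {v : Fin (n + 1) → ℝ} (hv : ∀ i, 0 ≤ v i) {c : ℝ}
    (hc : ∀ j, ∑ i : Fin (n + 1), ((-1) ^ (i : ℕ) * v i) * A i j = c * ((-1) ^ (j : ℕ) * v j))
    {i j : Fin (n + 1)} (hi : v i ≠ 0) (hj : v j = 0) : A i j = 0 := by
  set w : Fin (n + 1) → ℝ := fun i => (-1) ^ (i : ℕ) * v i with hw
  have h1 : Matrix.vecMul w A = c • w := by
    ext j
    simpa [Matrix.vecMul, dotProduct] using hc j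
  have h2 : A.det • w = c • Matrix.vecMul w A.adjugate := by
    rw [← Matrix.smul_vecMul, ← h1, Matrix.vecMul_vecMul, Matrix.mul_adjugate,
      Matrix.vecMul_smul, Matrix.vecMul_one]
  have hc0 : c ≠ 0 := by
    rintro rfl
    have := congrFun h2 i
    simp [hw, hdet, hi] at this
  have h3 : ∀ i j, v i ≠ 0 → v j = 0 → A.adjugate i j = 0 := by
    intro i j hi hj
    have hs : ∑ i, v i * (A.submatrix j.succAbove i.succAbove).det = 0 := by
      have e := congrFun h2 j
      simp only [Pi.smul_apply, hw, hj, mul_zero, smul_eq_mul, Matrix.vecMul, dotProduct,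
        Matrix.adjugate_fin_succ_eq_det_submatrix] at e
      have e := (mul_eq_zero.1 e.symm).resolve_left hc0
      -- The alternating signs of `w` cancel those of the cofactors, leaving a vanishing sum of
      -- nonnegative terms.
      have : (-1 : ℝ) ^ (j : ℕ) * ∑ i, v i * (A.submatrix j.succAbove i.succAbove).det = 0 := by
        rw [← e, Finset.mul_sum]
        refine Finset.sum_congr rfl fun i _ => ?_
        have : (-1 : ℝ) ^ (i : ℕ) * (-1) ^ (i : ℕ) = 1 := by rw [← mul_pow]; simp
        rw [pow_add]
        linear_combination (-(-1 : ℝ) ^ (j : ℕ) * v i *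
          (A.submatrix j.succAbove i.succAbove).det) * this
      exact (mul_eq_zero.1 this).resolve_left (by simp)
    have := (Finset.sum_eq_zero_iff_of_nonneg fun i _ => mul_nonneg (hv i)
      (hA n j.succAboveOrderEmb i.succAboveOrderEmb)).1 hs i (Finset.mem_univ i)
    rw [Matrix.adjugate_fin_succ_eq_det_submatrix]
    exact mul_eq_zero_of_right _ ((mul_eq_zero.1 this).resolve_left hi)
  have hu : IsUnit A.det := hdet.isUnit
  -- The zero pattern found for the inverse is block triangularity with respect to the support of
  -- `v`, which passes back to `A`.
  let b : Fin (n + 1) → ℕ := fun i => if v i = 0 then 0 else 1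
  have hb : ∀ i j, b j < b i ↔ v i ≠ 0 ∧ v j = 0 := by
    intro i j
    by_cases h1 : v i = 0 <;> by_cases h2 : v j = 0 <;> simp [b, h1, h2]
  have h4 : Matrix.BlockTriangular A⁻¹ b := by
    intro i j hij
    obtain ⟨hi, hj⟩ := (hb i j).1 hij
    simp [Matrix.inv_def, h3 i j hi hj]
  have : Invertible A⁻¹ := Matrix.invertibleOfIsUnitDet _ (Matrix.isUnit_nonsing_inv_det _ hu)
  have h5 := Matrix.blockTriangular_inv_of_blockTriangular h4
  rw [Matrix.nonsing_inv_nonsing_inv _ hu] at h5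
  exact h5 ((hb i j).2 ⟨hi, hj⟩)

/-- If the Krylov matrix were singular, the signed maximal minors of its first `n` columns would
span its left kernel. That kernel is invariant under `A`, so they form an alternating left
eigenvector. The resulting zeros of `A` contradict the positive subdiagonal. -/
theorem IsTotallyNonneg.krylovMinor_id_pos {A : Matrix (Fin (n + 1)) (Fin (n + 1)) ℝ}
    (hA : IsTotallyNonneg A) (hdet : A.det ≠ 0) (hsub : ∀ i : Fin n, 0 < A i.succ i.castSucc)
    (h : 0 < krylovMinor A (Fin.castSucc : Fin n → Fin (n + 1))) :
    0 < krylovMinor A (id : Fin (n + 1) → Fin (n + 1)) := by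
  refine lt_of_le_of_ne (hA.krylovMinor_nonneg (RelEmbedding.refl _)) fun h0 => ?_
  set R : Matrix (Fin (n + 1)) (Fin (n + 1)) ℝ := Matrix.of fun i j => (A ^ (j : ℕ)) i 0 with hR
  have hR0 : R.det = 0 := h0.symm
  let v : Fin (n + 1) → ℝ := fun j => krylovMinor A j.succAbove
  have hv : ∀ j, 0 ≤ v j := fun j => hA.krylovMinor_nonneg j.succAboveOrderEmb
  have hlast : 0 < v (Fin.last n) := by simpa [v] using h
  let w : Fin (n + 1) → ℝ := fun j => (-1) ^ (j : ℕ) * v j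
  have hw : ∀ k, ∑ i, w i * (A ^ k) i 0 = 0 := by
    refine vecMul_mul_pow_eq_zero fun k hk => ?_
    have h1 := congrFun (congrFun (Matrix.adjugate_mul R) (Fin.last n)) ⟨k, Nat.lt_succ_of_le hk⟩
    rw [hR0, zero_smul, Matrix.zero_apply, Matrix.mul_apply] at h1
    have h2 : ∀ j, R.adjugate (Fin.last n) j = (-1) ^ n * w j := by
      intro j
      rw [Matrix.adjugate_fin_succ_eq_det_submatrix, pow_add, Fin.val_last, Fin.succAbove_last]
      simp only [w, v, krylovMinor]
      rw [mul_comm ((-1 : ℝ) ^ (j : ℕ)), mul_assoc]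
      rfl
    simp only [h2, mul_assoc, ← Finset.mul_sum] at h1
    exact (mul_eq_zero.1 h1).resolve_left (by simp)
  have hwl : w (Fin.last n) ≠ 0 := mul_ne_zero (by simp) hlast.ne'
  let y : Fin (n + 1) → ℝ := fun j => ∑ i, w i * A i j
  have hy : ∀ k, ∑ i, y i * (A ^ k) i 0 = 0 := by
    intro k
    rw [← hw (k + 1)]
    simp only [y, pow_succ', Matrix.mul_apply, Finset.mul_sum, Finset.sum_mul, mul_assoc]
    exact Finset.sum_comm
  let c := y (Fin.last n) / w (Fin.last n)
  let z : Fin (n + 1) → ℝ := fun j => y j - c * w j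
  have hzl : z (Fin.last n) = 0 := by simp [z, c, hwl]
  -- `c` is chosen to cancel the last entry of `y - c w`; what remains is annihilated by the leading
  -- `n × n` Krylov block, invertible by `h`.
  have hz : ∀ j : Fin n, z j.castSucc = 0 := by
    have h1 : Matrix.vecMul (fun j : Fin n => z j.castSucc)
        (R.submatrix Fin.castSucc Fin.castSucc) = 0 := by
      ext k
      have : ∑ i, z i * (A ^ (k : ℕ)) i 0 = 0 := by
        simp only [z, sub_mul, Finset.sum_sub_distrib, mul_assoc, ← Finset.mul_sum, hy, hw]
        simp
      rw [Fin.sum_univ_castSucc, hzl, zero_mul, add_zero] at this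
      exact this
    exact congrFun (Matrix.eq_zero_of_vecMul_eq_zero h.ne' h1)
  have hc : ∀ j, ∑ i : Fin (n + 1), ((-1) ^ (i : ℕ) * v i) * A i j =
      c * ((-1) ^ (j : ℕ) * v j) := by
    intro j
    have : z j = 0 := Fin.lastCases hzl hz j
    exact sub_eq_zero.1 this
  have hz := fun i j => hA.apply_eq_zero_of_alternating hdet hv hc (i := i) (j := j)
  have hv0 : v 0 = 0 := by
    cases n with
    | zero => exact absurd h0 (by simp [krylovMinor])
    | succ n => exact krylovMinor_of_ne_zero A (0 : Fin (n + 2)).succAboveOrderEmb (by simp)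
  -- The zero at index `0` propagates along the subdiagonal up to the last index, where `v` is
  -- positive.
  refine hlast.ne' (Fin.induction (motive := fun j => v j = 0) hv0 (fun j hj => ?_) _)
  by_contra hne
  exact (hsub j).ne' (hz _ _ hne hj)

/-- Orders up to the size of the truncation are inherited from it; only the full determinant needs a
separate argument. -/
theorem IsTotallyNonneg.krylovMinor_castLE_pos {A : Matrix (Fin (n + 1)) (Fin (n + 1)) ℝ}
    (hA : IsTotallyNonneg A) (hdet : A.det ≠ 0) (hsub : ∀ i : Fin n, 0 < A i.succ i.castSucc)
    {k : ℕ} (hk : k ≤ n + 1) : 0 < krylovMinor A (Fin.castLE hk) := by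
  induction n generalizing k with
  | zero =>
    interval_cases k <;> simp [krylovMinor]
  | succ n ih =>
    have hlt : ∀ {k : ℕ} (hk : k ≤ n + 1),
        0 < krylovMinor A (Fin.castLE (hk.trans n.succ.le_succ)) :=
      fun {k} hk =>
        (ih (hA.submatrix Fin.castSuccOrderEmb Fin.castSuccOrderEmb)
          (hA.det_castSucc_pos hdet).ne' (fun i => hsub i.castSucc) hk).trans_le
            (hA.krylovMinor_castSucc_le (Fin.castLEOrderEmb hk))
    rcases hk.eq_or_lt with rfl | hk
    · exact hA.krylovMinor_id_pos hdet hsub (hlt le_rfl)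
    · exact hlt (Nat.lt_succ_iff.1 hk)

/-! ### Positivity of the functional `f ↦ f(A)₀₀` -/

/-- **Sylvester's criterion**: a symmetric matrix with positive leading principal minors is
positive definite. -/
theorem sum_mul_mul_pos_of_leading_minors_pos {H : Matrix (Fin n) (Fin n) ℝ}
    (hsymm : ∀ i j, H i j = H j i)
    (hH : ∀ (k : ℕ) (hk : k ≤ n), 0 < (H.submatrix (Fin.castLE hk) (Fin.castLE hk)).det)
    {x : Fin n → ℝ} (hx : x ≠ 0) : 0 < ∑ i, ∑ j, x i * x j * H i j := by
  induction n with
  | zero => exact absurd (Subsingleton.elim x 0) hx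
  | succ n ih =>
    have h0 : 0 < H 0 0 := by
      have := hH 1 (by omega)
      rwa [Matrix.det_fin_one] at this
    have hS : ∀ (k : ℕ) (hk : k ≤ n),
        0 < ((schur H).submatrix (Fin.castLE hk) (Fin.castLE hk)).det := by
      intro k hk
      have h1 := hH (k + 1) (by omega)
      rw [det_eq_mul_det_schur (by simpa using h0.ne')] at h1
      exact pos_of_mul_pos_right h1 h0.le
    set x' : Fin n → ℝ := fun i => x i.succ with hx'
    set s : ℝ := ∑ j, x' j * H 0 j.succ with hs
    set Q : ℝ := ∑ i, ∑ j, x' i * x' j * schur H i j with hQ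
    -- Completing the square in `x 0` leaves the quadratic form of the Schur complement.
    have key : ∑ i, ∑ j, x i * x j * H i j = (H 0 0 * x 0 + s) ^ 2 / H 0 0 + Q := by
      have e1 : Q = (∑ i, ∑ j, x' i * x' j * H i.succ j.succ) - s * s / H 0 0 := by
        rw [hQ, hs, Finset.sum_mul_sum, Finset.sum_div, ← Finset.sum_sub_distrib]
        refine Finset.sum_congr rfl fun i _ => ?_
        rw [Finset.sum_div, ← Finset.sum_sub_distrib]
        refine Finset.sum_congr rfl fun j _ => ?_
        rw [schur, Matrix.of_apply, hsymm i.succ 0]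
        ring
      have e2 : ∑ i : Fin n, x i.succ * x 0 * H i.succ 0 = x 0 * s := by
        rw [hs, Finset.mul_sum]
        exact Finset.sum_congr rfl fun i _ => by rw [hsymm i.succ 0]; ring
      have e3 : ∑ i : Fin n, x 0 * x i.succ * H 0 i.succ = x 0 * s := by
        rw [hs, Finset.mul_sum]
        exact Finset.sum_congr rfl fun i _ => by ring
      simp only [Fin.sum_univ_succ, Finset.sum_add_distrib]
      rw [e1, e2, e3]
      field_simp
      ring
    rw [key]
    have hsq : 0 ≤ (H 0 0 * x 0 + s) ^ 2 / H 0 0 := by positivity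
    by_cases hz : x' = 0
    · have hx0 : x 0 ≠ 0 := fun h => hx (funext fun i => Fin.cases h (fun i => congrFun hz i) i)
      have hs0 : s = 0 := by simp [hs, hz]
      have hQ0 : Q = 0 := by simp [hQ, hz]
      have := mul_ne_zero h0.ne' hx0
      rw [hs0, hQ0, add_zero, add_zero]
      positivity
    · have := ih (H := schur H) (fun i j => by
        simp only [schur, Matrix.of_apply]
        rw [hsymm i.succ j.succ, hsymm i.succ 0, hsymm 0 j.succ]; ring) hS hz
      linarith

/-- The functional `f ↦ f(A)₀₀`. -/
noncomputable def cornerForm (A : Matrix (Fin (n + 1)) (Fin (n + 1)) ℝ) : ℝ[X] →ₗ[ℝ] ℝ where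
  toFun f := aeval A f 0 0
  map_add' := by intros; simp
  map_smul' := by intros; simp

theorem cornerForm_apply (A : Matrix (Fin (n + 1)) (Fin (n + 1)) ℝ) (f : ℝ[X]) :
    cornerForm A f = aeval A f 0 0 := rfl

/-- Totally nonnegative nonsingular matrices with positive first sub- and superdiagonal. -/
structure IsPosBand (A : Matrix (Fin (n + 1)) (Fin (n + 1)) ℝ) : Prop where
  totallyNonneg : IsTotallyNonneg A
  nonsingular : A.det ≠ 0
  subdiag_pos : ∀ i : Fin n, 0 < A i.succ i.castSucc
  superdiag_pos : ∀ i : Fin n, 0 < A i.castSucc i.succ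

/-- The reversal moves the last diagonal entry, whose cofactor in `x - A` is `P_N`, to the corner
where the Krylov vectors start. -/
theorem IsOscillatory.isPosBand_rev {A : Matrix (Fin (n + 1)) (Fin (n + 1)) ℝ}
    (hA : IsOscillatory A) : IsPosBand (A.submatrix Fin.rev Fin.rev) where
  totallyNonneg := hA.totallyNonneg.rev
  nonsingular := by
    have := hA.nonsingular
    rwa [← Matrix.det_submatrix_equiv_self Fin.revPerm] at this
  subdiag_pos i := by
    have hA' : IsOscillatory A.transpose :=
      ⟨hA.totallyNonneg.transpose, hA.irreducible.transpose, by
        rw [Matrix.det_transpose]; exact hA.nonsingular⟩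
    simpa [Fin.rev_succ, Fin.rev_castSucc] using hA'.subdiag_pos i.rev
  superdiag_pos i := by
    simpa [Fin.rev_succ, Fin.rev_castSucc] using hA.subdiag_pos i.rev

/-- The Hankel matrix factors through the Krylov matrices of `Aᵀ` and `A`; the initial set of
indices contributes a positive Cauchy–Binet term. -/
theorem IsPosBand.hankel_det_pos {A : Matrix (Fin (n + 1)) (Fin (n + 1)) ℝ} (hA : IsPosBand A)
    {k : ℕ} (hk : k ≤ n + 1) :
    0 < (Matrix.of fun i j : Fin k => (A ^ ((i : ℕ) + j)) 0 0).det := by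
  have e : (Matrix.of fun i j : Fin k => (A ^ ((i : ℕ) + j)) 0 0) =
      (Matrix.of fun (i : Fin k) a => (A ^ (i : ℕ)) 0 a) *
        (Matrix.of fun a (j : Fin k) => (A ^ (j : ℕ)) a 0) := by
    ext i j
    simp [pow_add, Matrix.mul_apply]
  have e' : ∀ J : Fin k ↪o Fin (n + 1),
      ((Matrix.of fun (i : Fin k) a => (A ^ (i : ℕ)) 0 a).submatrix id J).det =
        krylovMinor A.transpose J := by
    intro J
    rw [krylovMinor, ← Matrix.det_transpose]
    congr 1
    ext i j
    simp [← Matrix.transpose_pow]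
  rw [e, Matrix.det_mul_eq_sum_orderEmb]
  refine Finset.sum_pos' (fun J _ => ?_) ⟨Fin.castLEOrderEmb hk, Finset.mem_univ _, ?_⟩
  · rw [e']
    exact mul_nonneg (hA.totallyNonneg.transpose.krylovMinor_nonneg J)
      (hA.totallyNonneg.krylovMinor_nonneg J)
  · rw [e']
    exact mul_pos (hA.totallyNonneg.transpose.krylovMinor_castLE_pos
        (by rw [Matrix.det_transpose]; exact hA.nonsingular) hA.superdiag_pos hk)
      (hA.totallyNonneg.krylovMinor_castLE_pos hA.nonsingular hA.subdiag_pos hk)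

theorem IsPosBand.cornerForm_sq_pos {A : Matrix (Fin (n + 1)) (Fin (n + 1)) ℝ} (hA : IsPosBand A)
    {f : ℝ[X]} (hf : f ≠ 0) (hdeg : f.natDegree ≤ n) : 0 < cornerForm A (f * f) := by
  have h1 := sum_mul_mul_pos_of_leading_minors_pos
    (H := Matrix.of fun i j : Fin (n + 1) => (A ^ ((i : ℕ) + j)) 0 0)
    (fun i j => by simp [add_comm]) (fun k hk => hA.hankel_det_pos hk)
    (x := fun i => f.coeff i) (fun h => hf (by
      ext i
      by_cases hi : i ≤ n
      · exact congrFun h ⟨i, Nat.lt_succ_of_le hi⟩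
      · simp [coeff_eq_zero_of_natDegree_lt (by omega : f.natDegree < i)]))
  have h2 : aeval A f = ∑ i : Fin (n + 1), f.coeff i • A ^ (i : ℕ) := by
    rw [aeval_eq_sum_range' (Nat.lt_succ_of_le hdeg),
      ← Fin.sum_univ_eq_sum_range fun i => f.coeff i • A ^ i]
  rw [cornerForm_apply, map_mul, h2, Finset.sum_mul_sum]
  simpa [Matrix.sum_apply, pow_add, mul_assoc, mul_left_comm] using h1

/-! ### The adjugate of `x - A` and the Wronskian -/

/-- The adjugate of `x - A` is the polynomial `(P(y) - P(x)) / (y - x)` at `y = A`, where `P` is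
the characteristic polynomial. -/
theorem adjugate_scalar_sub (A : Matrix (Fin n) (Fin n) ℝ) (x : ℝ) :
    (Matrix.scalar (Fin n) x - A).adjugate = aeval A (A.charpoly /ₘ (X - C x)) := by
  have hne : ∀ x, A.charpoly.eval x ≠ 0 →
      (Matrix.scalar (Fin n) x - A).adjugate = aeval A (A.charpoly /ₘ (X - C x)) := by
    intro x hx
    have h1 := congrArg (aeval A) (modByMonic_add_div A.charpoly (X - C x))
    rw [Matrix.aeval_self_charpoly, modByMonic_X_sub_C_eq_C_eval] at h1
    simp only [map_add, map_mul, map_sub, aeval_C, aeval_X] at h1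
    have h2 : (Matrix.scalar (Fin n) x - A) * aeval A (A.charpoly /ₘ (X - C x)) =
        A.charpoly.eval x • 1 := by
      rw [Algebra.algebraMap_eq_smul_one, add_eq_zero_iff_eq_neg, ← neg_mul, neg_sub] at h1
      exact h1.symm
    have h3 : (Matrix.scalar (Fin n) x - A).det = A.charpoly.eval x :=
      (Matrix.eval_charpoly A x).symm
    have h4 := congrArg ((Matrix.scalar (Fin n) x - A).adjugate * ·) h2
    simp only [← mul_assoc, Matrix.adjugate_mul, h3, Matrix.smul_mul, one_mul, Matrix.mul_smul,
      mul_one] at h4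
    exact (smul_right_injective _ hx h4).symm
  -- Both sides are continuous in `x`, so the finitely many eigenvalues are reached by density.
  have hd : Dense {x | A.charpoly.eval x = 0}ᶜ := by
    refine Set.Countable.dense_compl ℝ (Set.Finite.countable ?_)
    refine A.charpoly.roots.toFinset.finite_toSet.subset fun x hx => ?_
    simpa [A.charpoly_monic.ne_zero] using hx
  have hc1 : Continuous fun x : ℝ => (Matrix.scalar (Fin n) x - A).adjugate := by
    refine Continuous.matrix_adjugate (Continuous.sub ?_ continuous_const)
    exact Continuous.matrix_diagonal (continuous_pi fun _ => continuous_id)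
  have hc2 : Continuous fun x : ℝ => aeval A (A.charpoly /ₘ (X - C x)) := by
    have : ∀ x : ℝ, aeval A (A.charpoly /ₘ (X - C x)) =
        ∑ i ∈ Finset.range (A.charpoly.natDegree + 1),
          (A.charpoly /ₘ (X - C x)).coeff i • A ^ i := fun x =>
      aeval_eq_sum_range' (by rw [natDegree_divByMonic _ (monic_X_sub_C x)]; omega) _
    simp only [this, coeff_divByMonic_X_sub_C]
    fun_prop
  exact congrFun (Continuous.ext_on hd hc1 hc2 hne) x

theorem eval_charmatrix (A : Matrix (Fin n) (Fin n) ℝ) (x : ℝ) :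
    (evalRingHom x).mapMatrix A.charmatrix = Matrix.scalar (Fin n) x - A := by
  ext i j
  by_cases h : i = j
  · subst h; simp
  · simp [h]

theorem IsPosBand.adjugate_sq_pos {A : Matrix (Fin (n + 1)) (Fin (n + 1)) ℝ} (hA : IsPosBand A)
    (x : ℝ) : 0 < ((A.charmatrix.adjugate * A.charmatrix.adjugate) 0 0).eval x := by
  have h1 : ((A.charmatrix.adjugate * A.charmatrix.adjugate) 0 0).eval x =
      ((evalRingHom x).mapMatrix (A.charmatrix.adjugate * A.charmatrix.adjugate)) 0 0 := rfl
  rw [h1, map_mul, RingHom.map_adjugate, eval_charmatrix, adjugate_scalar_sub, ← map_mul]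
  have hdeg : A.charpoly.natDegree = n + 1 := by simp [A.charpoly_natDegree_eq_dim]
  refine hA.cornerForm_sq_pos (fun h => ?_) ?_
  · have h2 := modByMonic_add_div A.charpoly (X - C x)
    rw [h, mul_zero, add_zero, modByMonic_X_sub_C_eq_C_eval] at h2
    rw [← h2, natDegree_C] at hdeg
    omega
  · rw [natDegree_divByMonic _ (monic_X_sub_C x), natDegree_X_sub_C, hdeg]
    rfl

/-- Differentiate `adj(M) * M = det M • 1` for `M = x - A`, where `M' = 1`, and multiply by `adj(M)`
on the right. -/
theorem derivative_charpoly_mul_adjugate (A : Matrix (Fin n) (Fin n) ℝ) (i : Fin n) :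
    derivative A.charpoly * A.charmatrix.adjugate i i -
      derivative (A.charmatrix.adjugate i i) * A.charpoly =
        (A.charmatrix.adjugate * A.charmatrix.adjugate) i i := by
  have h1 : A.charmatrix.adjugate.map derivative * A.charmatrix + A.charmatrix.adjugate =
      derivative A.charpoly • (1 : Matrix (Fin n) (Fin n) ℝ[X]) := by
    ext1 i j
    have h := congrArg derivative (congrFun (congrFun (Matrix.adjugate_mul A.charmatrix) i) j)
    have hd : ∀ k, derivative (A.charmatrix k j) = if k = j then 1 else 0 := by
      intro k
      by_cases hk : k = j
      · subst hk; simp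
      · simp [hk]
    simp only [Matrix.mul_apply, derivative_sum, derivative_mul, hd, Finset.sum_add_distrib] at h
    simp only [mul_ite, mul_one, mul_zero, Finset.sum_ite_eq', Finset.mem_univ, if_true] at h
    rw [Matrix.add_apply, Matrix.mul_apply]
    simp only [Matrix.map_apply]
    rw [h]
    by_cases hij : i = j
    · subst hij; simp [Matrix.charpoly]
    · simp [hij]
  have h2 : A.charmatrix.adjugate.map derivative * A.charmatrix * A.charmatrix.adjugate +
      A.charmatrix.adjugate * A.charmatrix.adjugate =
        derivative A.charpoly • A.charmatrix.adjugate := by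
    rw [← add_mul, h1, Matrix.smul_mul, one_mul]
  rw [Matrix.mul_assoc, Matrix.mul_adjugate, Matrix.mul_smul, mul_one] at h2
  have h3 := congrFun (congrFun h2 i) i
  simp only [Matrix.add_apply, Matrix.smul_apply, Matrix.map_apply, smul_eq_mul] at h3
  rw [← h3, Matrix.charpoly]
  ring

/-! ### Real simple zeros and interlacing -/

/-- With cofactor `g`, the functional kills `P g = ((X - a) g)² + (b g)²`, yet it is positive on the
first square and nonnegative on the second. The case `b = 0` excludes double zeros, `b ≠ 0` nonreal
ones. -/
theorem IsPosBand.not_quadratic_dvd {A : Matrix (Fin (n + 1)) (Fin (n + 1)) ℝ} (hA : IsPosBand A)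
    (a b : ℝ) : ¬ (X - C a) ^ 2 + C (b ^ 2) ∣ A.charpoly := by
  rintro ⟨g, hg⟩
  have hdeg : A.charpoly.natDegree = n + 1 := by simp [A.charpoly_natDegree_eq_dim]
  have hg0 : g ≠ 0 := by
    rintro rfl
    exact A.charpoly_monic.ne_zero (by rw [hg, mul_zero])
  have hq : ((X - C a) ^ 2 + C (b ^ 2)).natDegree = 2 := by
    rw [natDegree_add_C, natDegree_pow, natDegree_X_sub_C]
  have hq0 : (X - C a) ^ 2 + C (b ^ 2) ≠ 0 := fun h => by rw [h] at hq; simp at hq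
  rw [hg, natDegree_mul hq0 hg0, hq] at hdeg
  have h0 : cornerForm A (A.charpoly * g) = 0 := by
    rw [cornerForm_apply, map_mul, Matrix.aeval_self_charpoly, zero_mul, Matrix.zero_apply]
  have h1 : A.charpoly * g = ((X - C a) * g) * ((X - C a) * g) + b ^ 2 • (g * g) := by
    rw [hg, smul_eq_C_mul]; ring
  rw [h1, map_add, map_smul, smul_eq_mul] at h0
  have h2 := hA.cornerForm_sq_pos (f := (X - C a) * g) (mul_ne_zero (X_sub_C_ne_zero a) hg0) (by
    rw [natDegree_mul (X_sub_C_ne_zero a) hg0, natDegree_X_sub_C]; omega)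
  have h3 := hA.cornerForm_sq_pos hg0 (by omega)
  nlinarith [mul_nonneg (sq_nonneg b) h3.le]

theorem IsPosBand.nodup_roots_charpoly {A : Matrix (Fin (n + 1)) (Fin (n + 1)) ℝ}
    (hA : IsPosBand A) : A.charpoly.roots.Nodup := by
  rw [Multiset.nodup_iff_count_le_one]
  intro a
  rw [count_roots]
  by_contra h
  have h2 : 2 ≤ A.charpoly.rootMultiplicity a := by omega
  refine hA.not_quadratic_dvd a 0 ?_
  simpa using (le_rootMultiplicity_iff A.charpoly_monic.ne_zero).1 h2

theorem IsPosBand.splits_charpoly {A : Matrix (Fin (n + 1)) (Fin (n + 1)) ℝ}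
    (hA : IsPosBand A) : A.charpoly.Splits := by
  refine Splits.of_splits_map (algebraMap ℝ ℂ) (IsAlgClosed.splits _) fun z hz => ?_
  have hz0 : aeval z A.charpoly = 0 := by
    have := (mem_roots'.1 hz).2
    rwa [IsRoot, eval_map_algebraMap] at this
  by_cases him : z.im = 0
  · exact ⟨z.re, Complex.ext (by simp) (by simp [him])⟩
  · have := quadratic_dvd_of_aeval_eq_zero_im_ne_zero A.charpoly hz0 him
    refine absurd this ?_
    convert hA.not_quadratic_dvd z.re z.im using 2
    rw [← Complex.normSq_eq_norm_sq, Complex.normSq_apply]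
    simp only [map_add, map_mul, map_pow, C_ofNat]
    ring

/-- If the Wronskian `f' g - g' f` is positive, there is a zero of `g` between any two zeros
of `f`. -/
theorem exists_root_Ioo_of_wronskian_pos {f g : ℝ[X]}
    (hW : ∀ x : ℝ, 0 < (derivative f * g - derivative g * f).eval x) {a b : ℝ} (hab : a < b)
    (ha : f.IsRoot a) (hb : f.IsRoot b) : ∃ c ∈ Set.Ioo a b, g.IsRoot c := by
  by_contra! h
  have hends : ∀ x, f.IsRoot x → g.eval x ≠ 0 := by
    intro x hx hg
    have := hW x
    simp [hg, hx.eq_zero] at this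
  have hg : ∀ x ∈ Set.Icc a b, g.eval x ≠ 0 := by
    intro x hx
    rcases hx.1.eq_or_lt with rfl | h1
    · exact hends _ ha
    rcases hx.2.eq_or_lt with rfl | h2
    · exact hends _ hb
    exact h x ⟨h1, h2⟩
  -- Rolle's theorem for `f / g`, whose derivative is the Wronskian over `g²`.
  have hd : ∀ x ∈ Set.Icc a b, HasDerivAt (fun y => f.eval y / g.eval y)
      (((derivative f).eval x * g.eval x - f.eval x * (derivative g).eval x) / g.eval x ^ 2) x :=
    fun x hx => (f.hasDerivAt x).div (g.hasDerivAt x) (hg x hx)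
  obtain ⟨c, hc, hc0⟩ := exists_hasDerivAt_eq_zero hab
    (fun x hx => (hd x hx).continuousAt.continuousWithinAt)
    (by simp [ha.eq_zero, hb.eq_zero]) (fun x hx => hd x (Set.Ioo_subset_Icc_self hx))
  have := hW c
  rw [div_eq_zero_iff, or_iff_left (pow_ne_zero 2 (hg c (Set.Ioo_subset_Icc_self hc)))] at hc0
  simp only [eval_sub, eval_mul] at this
  linarith

theorem interlaces_of_wronskian_pos {f g : ℝ[X]} {n : ℕ} (hf : f.natDegree = n + 1)
    (hs : f.Splits) (hnd : f.roots.Nodup) (hg : g.natDegree = n) (hg0 : g ≠ 0)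
    (hW : ∀ x : ℝ, 0 < (derivative f * g - derivative g * f).eval x) : Interlaces f g := by
  have hcard : f.roots.toFinset.card = n + 1 := by
    rw [Multiset.toFinset_card_of_nodup hnd, ← hs.natDegree_eq_card_roots, hf]
  have hf0 : f ≠ 0 := by rintro rfl; simp at hf
  let e := f.roots.toFinset.orderEmbOfFin hcard
  -- `e` lists the zeros increasingly, while `Interlaces` wants them decreasing.
  let lam : Fin (n + 1) → ℝ := fun k => e k.rev
  have hlam : StrictAnti lam := fun i j hij => e.strictMono (Fin.rev_lt_rev.2 hij)
  have hroot : ∀ k, f.IsRoot (lam k) := fun k => by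
    have := f.roots.toFinset.orderEmbOfFin_mem hcard k.rev
    rw [Multiset.mem_toFinset, mem_roots hf0] at this
    exact this
  have hmu : ∀ k : Fin n, ∃ c ∈ Set.Ioo (lam k.succ) (lam k.castSucc), g.IsRoot c := fun k =>
    exists_root_Ioo_of_wronskian_pos hW (hlam Fin.castSucc_lt_succ) (hroot _) (hroot _)
  choose mu hmu1 hmu2 using hmu
  have hmu_anti : StrictAnti mu := by
    intro i j hij
    calc mu j < lam j.castSucc := (hmu1 j).2
      _ ≤ lam i.succ := hlam.antitone (Fin.succ_le_castSucc_iff.2 hij)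
      _ < mu i := (hmu1 i).1
  have eq_of_roots : ∀ {m : ℕ} {h : ℝ[X]} (v : Fin m → ℝ), h ≠ 0 → Function.Injective v →
      (∀ k, h.IsRoot (v k)) → h.natDegree = m → h.roots = Finset.univ.val.map v := by
    intro m h v h0 hv hr hm
    symm
    refine Multiset.eq_of_le_of_card_le ?_ ?_
    · rw [Multiset.le_iff_subset ((Multiset.nodup_map_iff_of_injective hv).2 Finset.univ.nodup)]
      intro x hx
      obtain ⟨k, -, rfl⟩ := Multiset.mem_map.1 hx
      exact (mem_roots h0).2 (hr k)
    · refine h.card_roots'.trans ?_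
      simp [hm]
  exact ⟨hg0, n, lam, mu, hf, hg, eq_of_roots lam hf0 hlam.injective hroot hf,
    eq_of_roots mu hg0 hmu_anti.injective hmu2 hg, fun k => ⟨(hmu1 k).2, (hmu1 k).1⟩⟩

/-! ### The determinants `Q_{n,N}` as entries of the adjugate -/

theorem charPoly_monic (T : Matrix ℕ ℕ ℝ) (N : ℕ) : (charPoly T N).Monic := by
  cases N with
  | zero => exact monic_one
  | succ N => exact (trunc T N).charpoly_monic

theorem natDegree_charPoly (T : Matrix ℕ ℕ ℝ) (N : ℕ) : (charPoly T N).natDegree = N := by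
  cases N with
  | zero => exact natDegree_one
  | succ N => simp [charPoly, Matrix.charpoly_natDegree_eq_dim]

theorem adjugate_charmatrix_trunc_last (T : Matrix ℕ ℕ ℝ) (N : ℕ) :
    (trunc T N).charmatrix.adjugate (Fin.last N) (Fin.last N) = charPoly T N := by
  rw [Matrix.adjugate_fin_succ_eq_det_submatrix, ← two_mul, pow_mul, neg_one_sq, one_pow, one_mul,
    Fin.succAbove_last]
  cases N with
  | zero => simp [charPoly]
  | succ N =>
    rw [charPoly, Matrix.charpoly]
    congr 1
    ext1 i j
    by_cases h : i = j
    · subst h; simp [trunc]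
    · simp [h, trunc]

theorem alpha_succ (p : ℕ) (T : Matrix ℕ ℕ ℝ) (N : ℕ) :
    alpha p T (N + 1) = (-1) ^ (p - 1) * T (N + p) N * alpha p T N := by
  simp only [alpha, Finset.prod_range_succ, mul_add, pow_add, mul_one]
  ring

variable {p : ℕ} {T : Matrix ℕ ℕ ℝ}

theorem detQ_eq_zero (ν : Matrix (Fin p) (Fin p) ℝ) {n N : ℕ} (h1 : N < n) (h2 : n < N + p) :
    detQ p T ν n N = 0 := by
  have hp : 0 < p := by omega
  refine Matrix.det_zero_of_row_eq (i := ⟨0, hp⟩) (j := ⟨n - N, by omega⟩) ?_ ?_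
  · simp only [ne_eq, Fin.mk.injEq]; omega
  · ext1 a
    simp only [Matrix.of_apply, if_pos, if_neg (by omega : ¬ n - N = 0)]
    congr 1
    omega

theorem detQ_zero_zero {ν : Matrix (Fin p) (Fin p) ℝ} (hν : IsLowerUnitriangular ν) :
    detQ p T ν 0 0 = 1 := by
  have e : (Matrix.of fun i a : Fin p =>
      leftPoly p T ν a (if (i : ℕ) = 0 then 0 else 0 + (i : ℕ))) = ν.map C := by
    ext1 i a
    rw [Matrix.of_apply, Matrix.map_apply, ← leftPoly_init p T ν a i]
    congr 1
    split_ifs <;> omega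
  have hdet : ν.det = 1 := by
    rw [Matrix.det_of_isLowerTriangular ν fun i j hij => hν.upper i j hij]
    simp [hν.diag]
  rw [detQ, e]
  have := C.map_det ν
  rw [hdet, map_one] at this
  exact this.symm

/-- The two matrices differ by a cyclic permutation of `p + 1` rows, of sign `(-1) ^ p`; this is the
source of the sign in `alpha`. -/
theorem detQ_succ_succ (ν : Matrix (Fin (p + 1)) (Fin (p + 1)) ℝ) (N : ℕ) :
    detQ (p + 1) T ν (N + 1) (N + 1) = (-1) ^ p * detQ (p + 1) T ν (N + (p + 1)) N := by
  have h := Matrix.det_permute (finRotate (p + 1)) (Matrix.of fun i a : Fin (p + 1) =>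
    leftPoly (p + 1) T ν a (if (i : ℕ) = 0 then N + (p + 1) else N + (i : ℕ)))
  rw [sign_finRotate] at h
  rw [detQ, detQ]
  convert! h using 1
  · congr 1
    ext1 i a
    refine Fin.lastCases ?_ (fun i => ?_) i
    · simp only [Matrix.of_apply, Matrix.submatrix_apply, finRotate_last]
      congr 1
      simp only [Fin.val_last, Fin.val_zero]
      split_ifs <;> omega
    · simp only [Matrix.of_apply, Matrix.submatrix_apply, finRotate_apply,
        Fin.coeSucc_eq_succ]
      congr 1
      simp only [Fin.val_castSucc, Fin.val_succ]
      rw [if_neg (Nat.succ_ne_zero _)]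
      split_ifs with h0
      · rw [h0]
      · exact (add_assoc N 1 _).trans (congrArg (N + ·) (add_comm 1 _))
  · simp

/-- The recursion for the `Q_{n,N}` in `n`, column by column. -/
theorem sum_detQ_mul (hsub : ∀ n, T (n + p) n ≠ 0) (hp : 1 ≤ p) (ν : Matrix (Fin p) (Fin p) ℝ)
    (N m : ℕ) :
    ∑ k ∈ Finset.range (m + p + 1), detQ p T ν k N * C (T k m) = X * detQ p T ν m N := by
  obtain ⟨p, rfl⟩ : ∃ p', p = p' + 1 := ⟨p - 1, by omega⟩
  -- Only the first row depends on `k`, so its cofactors are coefficients independent of `k`.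
  obtain ⟨c, hc⟩ : ∃ c : Fin (p + 1) → ℝ[X], ∀ k,
      detQ (p + 1) T ν k N = ∑ a, c a * leftPoly (p + 1) T ν a k := by
    refine ⟨fun a => (-1) ^ (a : ℕ) * ((Matrix.of fun i a : Fin (p + 1) =>
      leftPoly (p + 1) T ν a (if (i : ℕ) = 0 then 0 else N + (i : ℕ))).submatrix
        Fin.succ a.succAbove).det, fun k => ?_⟩
    rw [detQ, Matrix.det_succ_row_zero]
    refine Finset.sum_congr rfl fun a _ => ?_
    rw [Matrix.of_apply, if_pos (by simp), mul_right_comm]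
    congr 3
  simp only [hc, Finset.sum_mul, Finset.mul_sum]
  rw [Finset.sum_comm]
  refine Finset.sum_congr rfl fun a _ => ?_
  simp only [mul_assoc, ← Finset.mul_sum]
  rw [leftPoly_mul ν a m (hsub m)]
  ring

/-- As `Q_{n,N}` vanishes for `N < n < N + p`, the band structure leaves a single boundary term when
the recursion is truncated. -/
theorem vecMul_detQ (hlow : ∀ i j, j + p < i → T i j = 0) (hsub : ∀ n, T (n + p) n ≠ 0)
    (hp : 1 ≤ p) (ν : Matrix (Fin p) (Fin p) ℝ) (N : ℕ) :
    Matrix.vecMul (fun n : Fin (N + 1) => detQ p T ν n N) (trunc T N).charmatrix =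
      Pi.single (Fin.last N) (detQ p T ν (N + p) N * C (T (N + p) N)) := by
  ext1 m
  have h1 : ∑ k ∈ Finset.range (N + 1), detQ p T ν k N * C (T k m) +
      detQ p T ν (N + p) N * C (T (N + p) m) = X * detQ p T ν m N := by
    rw [← sum_detQ_mul hsub hp ν N m]
    have e1 : ∑ k ∈ Finset.range (m + p + 1), detQ p T ν k N * C (T k m) =
        ∑ k ∈ Finset.range (N + p + 1), detQ p T ν k N * C (T k m) := by
      refine Finset.sum_subset (Finset.range_subset_range.2 (by omega)) fun k _ hk => ?_
      rw [hlow k m (by simp at hk; omega), C_0, mul_zero]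
    have e2 : ∑ k ∈ Finset.range (N + 1), detQ p T ν k N * C (T k m) =
        ∑ k ∈ Finset.range (N + p), detQ p T ν k N * C (T k m) := by
      refine Finset.sum_subset (Finset.range_subset_range.2 (by omega)) fun k hk hk' => ?_
      rw [detQ_eq_zero ν (by simp at hk'; omega) (by simpa using hk), zero_mul]
    rw [e1, e2, Finset.sum_range_succ]
  have h2 : Matrix.vecMul (fun n : Fin (N + 1) => detQ p T ν n N) (trunc T N).charmatrix m =
      X * detQ p T ν m N - ∑ k ∈ Finset.range (N + 1), detQ p T ν k N * C (T k m) := by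
    rw [← Fin.sum_univ_eq_sum_range fun k => detQ p T ν k N * C (T k m)]
    simp only [Matrix.vecMul, dotProduct, Matrix.charmatrix, Matrix.sub_apply, mul_sub,
      Finset.sum_sub_distrib]
    congr 1
    simp [Matrix.diagonal_apply, mul_comm]
  rw [h2, ← h1, add_sub_cancel_left]
  by_cases hm : m = Fin.last N
  · subst hm; simp
  · rw [Pi.single_eq_of_ne hm, hlow (N + p) m (by
      have := Fin.val_lt_last hm
      omega), C_0, mul_zero]

theorem C_alpha_mul_charPoly_mul_detQ (hlow : ∀ i j, j + p < i → T i j = 0)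
    (hsub : ∀ n, T (n + p) n ≠ 0) (hp : 1 ≤ p) (ν : Matrix (Fin p) (Fin p) ℝ) (N : ℕ)
    (n : Fin (N + 1)) :
    charPoly T (N + 1) * (C (alpha p T N) * detQ p T ν n N) =
      C (alpha p T (N + 1)) * detQ p T ν (N + 1) (N + 1) *
        (trunc T N).charmatrix.adjugate (Fin.last N) n := by
  have h := congrFun (congrArg (fun v => Matrix.vecMul v (trunc T N).charmatrix.adjugate)
    (vecMul_detQ hlow hsub hp ν N)) n
  simp only [Matrix.vecMul_vecMul, Matrix.mul_adjugate, Matrix.vecMul_smul, Matrix.vecMul_one,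
    Pi.smul_apply, smul_eq_mul, Matrix.single_vecMul] at h
  obtain ⟨p, rfl⟩ : ∃ p', p = p' + 1 := ⟨p - 1, by omega⟩
  have hs : ((-1 : ℝ[X]) ^ p) * (-1) ^ p = 1 := by rw [← mul_pow]; simp
  rw [charPoly, Matrix.charpoly, mul_left_comm, h, alpha_succ, detQ_succ_succ]
  simp only [C_mul, C_pow, C_neg, C_1, Nat.add_sub_cancel, Matrix.row]
  linear_combination (-(C (T (N + (p + 1)) N)) * C (alpha (p + 1) T N) *
    detQ (p + 1) T ν (N + (p + 1)) N * (trunc T N).charmatrix.adjugate (Fin.last N) n) * hs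

/-- The preceding identity at `n = N`, where the adjugate entry is `P_N`, drives the induction: the
factor `P_N` cancels. -/
theorem C_alpha_mul_detQ_self (hlow : ∀ i j, j + p < i → T i j = 0)
    (hsub : ∀ n, T (n + p) n ≠ 0) (hp : 1 ≤ p) {ν : Matrix (Fin p) (Fin p) ℝ}
    (hν : IsLowerUnitriangular ν) (N : ℕ) :
    C (alpha p T N) * detQ p T ν N N = charPoly T N := by
  induction N with
  | zero => simp [detQ_zero_zero hν, alpha, charPoly]
  | succ N ih =>
    have h := C_alpha_mul_charPoly_mul_detQ hlow hsub hp ν N (Fin.last N)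
    rw [adjugate_charmatrix_trunc_last, Fin.val_last, ih] at h
    exact (mul_right_cancel₀ (charPoly_monic T N).ne_zero h).symm

/-- The `Q_{n,N}` are, up to the factor `α_N`, the entries of the last row of the adjugate of
`x - T^{[N]}`. -/
theorem C_alpha_mul_detQ (hlow : ∀ i j, j + p < i → T i j = 0)
    (hsub : ∀ n, T (n + p) n ≠ 0) (hp : 1 ≤ p) {ν : Matrix (Fin p) (Fin p) ℝ}
    (hν : IsLowerUnitriangular ν) (N : ℕ) (n : Fin (N + 1)) :
    C (alpha p T N) * detQ p T ν n N = (trunc T N).charmatrix.adjugate (Fin.last N) n := by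
  have h := C_alpha_mul_charPoly_mul_detQ hlow hsub hp ν N n
  rw [C_alpha_mul_detQ_self hlow hsub hp hν (N + 1)] at h
  exact mul_left_cancel₀ (charPoly_monic T (N + 1)).ne_zero h

/-! ### Undoing the reversal, and the conclusion -/

theorem charmatrix_adjugate_rev (B : Matrix (Fin n) (Fin n) ℝ) :
    (B.submatrix Fin.rev Fin.rev).charmatrix.adjugate =
      B.charmatrix.adjugate.submatrix Fin.rev Fin.rev := by
  have h := Matrix.adjugate_reindex Fin.revPerm B.charmatrix
  rw [← Matrix.charmatrix_reindex] at h
  exact h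

theorem charpoly_rev (B : Matrix (Fin n) (Fin n) ℝ) :
    (B.submatrix Fin.rev Fin.rev).charpoly = B.charpoly :=
  Matrix.charpoly_reindex Fin.revPerm B

theorem IsOscillatory.adjugate_sq_pos {B : Matrix (Fin (n + 1)) (Fin (n + 1)) ℝ}
    (hB : IsOscillatory B) (x : ℝ) :
    0 < ((B.charmatrix.adjugate * B.charmatrix.adjugate) (Fin.last n) (Fin.last n)).eval x := by
  have h := hB.isPosBand_rev.adjugate_sq_pos x
  have e := Matrix.submatrix_mul_equiv B.charmatrix.adjugate B.charmatrix.adjugate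
    Fin.rev Fin.revPerm Fin.rev
  rw [charmatrix_adjugate_rev] at h
  erw [e] at h
  simpa using h

end BandedFavard

open BandedFavard in
theorem mainTheorem9 (p q : ℕ) (hp : 1 ≤ p) (hq : 1 ≤ q) (T : Matrix ℕ ℕ ℝ)
    (hT : IsBanded p q T)
    (ν : Matrix (Fin p) (Fin p) ℝ) (hν : IsLowerUnitriangular ν)
    (ξ : Matrix (Fin q) (Fin q) ℝ) (hξ : IsLowerUnitriangular ξ)
    (N : ℕ) (hosc : IsOscillatory (trunc T N)) :
    Interlaces (charPoly T (N + 1)) (charPoly T N) ∧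
    (∀ x : ℝ, 0 < (derivative (charPoly T (N + 1)) * charPoly T N -
        derivative (charPoly T N) * charPoly T (N + 1)).eval x) ∧
    (∀ x : ℝ, (charPoly T (N + 1)).IsRoot x →
        0 < (derivative (charPoly T (N + 1)) * charPoly T N).eval x) ∧
    (∀ x : ℝ, (charPoly T N).IsRoot x →
        (charPoly T (N + 1) * derivative (charPoly T N)).eval x < 0) ∧
    (∀ x : ℝ, 0 < alpha p T N * beta q T N *
        ∑ n ∈ Finset.range (N + 1), (detQ p T ν n N).eval x * (detR q T ξ n N).eval x) := by
  have hW : ∀ x : ℝ, 0 < (derivative (charPoly T (N + 1)) * charPoly T N -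
      derivative (charPoly T N) * charPoly T (N + 1)).eval x := by
    intro x
    have h := derivative_charpoly_mul_adjugate (trunc T N) (Fin.last N)
    rw [adjugate_charmatrix_trunc_last] at h
    rw [charPoly, h]
    exact hosc.adjugate_sq_pos x
  have hA := hosc.isPosBand_rev
  have hsplit : (charPoly T (N + 1)).Splits := by
    rw [charPoly, ← charpoly_rev]; exact hA.splits_charpoly
  have hnodup : (charPoly T (N + 1)).roots.Nodup := by
    rw [charPoly, ← charpoly_rev]; exact hA.nodup_roots_charpoly
  refine ⟨interlaces_of_wronskian_pos (natDegree_charPoly T (N + 1)) hsplit hnodup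
    (natDegree_charPoly T N) (charPoly_monic T N).ne_zero hW, hW, fun x hx => ?_, fun x hx => ?_,
    fun x => ?_⟩
  · have := hW x
    rwa [eval_sub, eval_mul (p := derivative (charPoly T N)), hx.eq_zero, mul_zero,
      sub_zero] at this
  · have := hW x
    rw [eval_sub, eval_mul, hx.eq_zero, mul_zero, zero_sub, mul_comm] at this
    exact neg_pos.1 this
  · have hR : ∀ n : Fin (N + 1), C (beta q T N) * detR q T ξ n N =
        (trunc T N).charmatrix.adjugate n (Fin.last N) := by
      intro n
      -- The right polynomials are the left ones of `Tᵀ`, so the last row of the adjugate becomes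
      -- the last column.
      have h := C_alpha_mul_detQ (T := T.transpose) (fun i j => hT.upper j i)
        hT.super_ne_zero hq hξ N n
      have e : trunc T.transpose N = (trunc T N).transpose := rfl
      rw [e, Matrix.charmatrix_transpose, ← Matrix.adjugate_transpose] at h
      exact h
    have h := hosc.adjugate_sq_pos x
    rw [Matrix.mul_apply, eval_finsetSum] at h
    rw [Finset.mul_sum, ← Fin.sum_univ_eq_sum_range fun n => alpha p T N * beta q T N *
      ((detQ p T ν n N).eval x * (detR q T ξ n N).eval x)]
    refine h.trans_eq (Finset.sum_congr rfl fun n _ => ?_)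
    rw [← C_alpha_mul_detQ hT.lower hT.sub_ne_zero hp hν N n, ← hR n]
    simp only [eval_mul, eval_C]
    ring
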